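/- Let $d \ge 2$ be an integer and let $\varepsilon > 0$. Every free action of $\mathbb{Z}^d$ on the circle $\mathbb{R}/\mathbb{Z}$ by diffeomorphisms of class $C^{1+1/d+\varepsilon}$ is minimal. Here a self-map of the circle is of class $C^r$ (with $r \ge 1$ real) if it has a lift $F : \mathbb{R} \to \mathbb{R}$ that is of class $C^k$, $k = \lfloor r \rfloor$, and for which there is a constant $C$ with $|F^{(k)}(x) - F^{(k)}(y)| \le C\,|x-y|^{r-k}$ for all $x, y \in \mathbb{R}$ (for $r = 1+\tau$ with $0 < \tau < 1$: the derivative is $\tau$-Hölder continuous). A diffeomorphism of class $C^r$ is a bijection that is of class $C^r$ together with its inverse; it is not assumed to preserve the orientation. The action is free if no nonzero element of $\mathbb{Z}^d$ has a fixed point, and minimal if every orbit is dense. -/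

import Mathlib

/-- A self-map `f` of the circle `ℝ/ℤ` is of class `C^r` (for a real number `r ≥ 1`) if it has
a lift `F : ℝ → ℝ` that is `k = ⌊r⌋` times continuously differentiable and whose `k`-th derivative
is Hölder continuous with exponent `r - k`. The derivatives of a lift are `1`-periodic, so this is
Hölder continuity on the circle, and for integer `r` the second condition holds automatically. For
`r = 1 + τ` with `0 < τ < 1` it says that `f` is `C^1` and `|f'(x) - f'(y)| ≤ C |x - y| ^ τ`. -/
def IsCircleMapOfClass (r : ℝ) (f : UnitAddCircle → UnitAddCircle) : Prop :=
  ∃ F : ℝ → ℝ, (∀ x : ℝ, ((F x : ℝ) : UnitAddCircle) = f (x : UnitAddCircle)) ∧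
    ContDiff ℝ (⌊r⌋₊ : ℕ) F ∧
    ∃ C : ℝ, ∀ x y : ℝ,
      |iteratedDeriv ⌊r⌋₊ F x - iteratedDeriv ⌊r⌋₊ F y| ≤ C * |x - y| ^ (r - (⌊r⌋₊ : ℝ))

/-- A diffeomorphism of class `C^r` of the circle: a bijection of class `C^r` whose inverse is
of class `C^r`. -/
def IsCircleDiffeoOfClass (r : ℝ) (f : UnitAddCircle ≃ UnitAddCircle) : Prop :=
  IsCircleMapOfClass r f ∧ IsCircleMapOfClass r f.symm

/-- An additive group acts freely if no nonzero element has a fixed point. -/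
def IsFreeAddAction (G X : Type*) [AddGroup G] [AddAction G X] : Prop :=
  ∀ (g : G) (x : X), g +ᵥ x = x → g = 0

open Set Filter Topology

/-! The argument is Denjoy's, with the second derivative replaced by a choice of path in `ℕ^d`.
Freeness makes the rotation numbers of nonzero elements irrational, and the lifts are simultaneously
semiconjugate to translations by a continuous monotone `h`. If `h` is injective, the action is
minimal. Otherwise `h` collapses a maximal interval ending at `b`, whose images are disjoint on the
circle and so have summable lengths `l v` (`summable_lift_sub`).

Distortion along a lattice path is controlled by the sum of `l v ^ σ`. A Pólya urn path is uniformly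
distributed on each level of `ℕ^d`, and its expected cost stays bounded when `σ > 1 / d`; hence
cheap paths reach every level (`exists_latticePathCost_bounded`). Along them a short interval `[b, b
+ δ]` stays no longer than the collapsed one (`LatticePathCost.ratio_le`). Boundedly many more steps
along one axis bring the image of `b` back just to the right of `b`. The resulting element maps `[b,
b + δ]` into itself modulo integers and so fixes a point, against freeness
(`strictMono_of_ratio_distortion`). -/

/-! ### Lifts of circle maps and their degree -/

theorem unitAddCircle_coe_eq_coe_iff {x y : ℝ} :
    (x : UnitAddCircle) = y ↔ ∃ m : ℤ, x = y + m := by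
  rw [← sub_eq_zero, ← AddCircle.coe_sub, AddCircle.coe_eq_zero_iff]
  refine exists_congr fun m => ?_
  simp only [zsmul_eq_mul, mul_one]
  constructor <;> intro h <;> linarith

theorem exists_int_forall_eq_of_continuous {f : ℝ → ℝ} (hf : Continuous f)
    (h : ∀ x, ∃ m : ℤ, f x = m) : ∃ m : ℤ, ∀ x, f x = m := by
  choose m hm using h
  have hc : Continuous m := by
    rw [Int.isClosedEmbedding_coe_real.isInducing.continuous_iff]
    exact hf.congr hm
  exact ⟨m 0, fun x => by rw [hm, PreconnectedSpace.constant inferInstance hc]⟩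

theorem exists_int_forall_eq_add_of_coe_eq {F G : ℝ → ℝ} (hF : Continuous F) (hG : Continuous G)
    (h : ∀ x, (F x : UnitAddCircle) = G x) : ∃ m : ℤ, ∀ x, F x = G x + m := by
  obtain ⟨m, hm⟩ := exists_int_forall_eq_of_continuous (hF.sub hG) fun x => by
    obtain ⟨m, hm⟩ := unitAddCircle_coe_eq_coe_iff.1 (h x)
    exact ⟨m, by simp [hm]⟩
  exact ⟨m, fun x => by have := hm x; simp only [Pi.sub_apply] at this; linarith⟩

/-- A continuous lift of a fixed point free self-map of the circle has degree one. -/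
theorem lift_add_one_of_fixedPointFree {f : UnitAddCircle → UnitAddCircle} {F : ℝ → ℝ}
    (hF : Continuous F) (hlift : ∀ x : ℝ, (F x : UnitAddCircle) = f x)
    (hfix : ∀ x, f x ≠ x) (x : ℝ) : F (x + 1) = F x + 1 := by
  obtain ⟨k, hk⟩ := exists_int_forall_eq_add_of_coe_eq (F := fun x => F (x + 1)) (G := F)
    (by fun_prop) hF fun x => by simp [hlift]
  suffices hk1 : k = 1 by simpa [hk1] using hk x
  by_contra hne
  have hno : ∀ (y : ℝ) (m : ℤ), F y - y ≠ m := fun y m h => by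
    refine hfix y ?_
    rw [← hlift, unitAddCircle_coe_eq_coe_iff]
    exact ⟨m, by linarith⟩
  have hcont : ContinuousOn (fun y => F y - y) (Icc 0 1) := by fun_prop
  have h1 : F 1 = F 0 + k := by simpa using hk 0
  rcases lt_or_gt_of_ne hne with hlt | hgt
  -- The displacement changes by `k - 1` over `[0, 1]`. For `k ≠ 1` it therefore sweeps an interval
  -- of length at least one and meets an integer; this also rules out reversed orientation.
  · have hk' : (k : ℝ) ≤ 0 := by exact_mod_cast (by omega : k ≤ 0)
    obtain ⟨y, -, hy⟩ := intermediate_value_Icc' zero_le_one hcont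
      (show ((⌊F 0⌋ : ℤ) : ℝ) ∈ _ from ⟨by linarith [Int.lt_floor_add_one (F 0)],
        by linarith [Int.floor_le (F 0)]⟩)
    exact hno y _ hy
  · have hk' : (2 : ℝ) ≤ k := by exact_mod_cast (by omega : 2 ≤ k)
    obtain ⟨y, -, hy⟩ := intermediate_value_Icc zero_le_one hcont
      (show ((⌈F 0⌉ : ℤ) : ℝ) ∈ _ from ⟨by linarith [Int.le_ceil (F 0)],
        by linarith [Int.ceil_lt_add_one (F 0)]⟩)
    exact hno y _ hy

/-! ### Hölder derivatives and distortion -/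

theorem periodic_deriv_of_map_add_one {F : ℝ → ℝ} (h : ∀ x, F (x + 1) = F x + 1) :
    Function.Periodic (deriv F) 1 := fun x => by
  rw [← deriv_comp_add_const]
  simp [h]

theorem exists_abs_le_of_periodic {g : ℝ → ℝ} (hg : Continuous g) (hp : Function.Periodic g 1) :
    ∃ M, ∀ x, |g x| ≤ M := by
  obtain ⟨M, hM⟩ := isCompact_Icc.exists_bound_of_continuousOn (s := Icc (0 : ℝ) 1) hg.continuousOn
  refine ⟨M, fun x => ?_⟩
  obtain ⟨y, hy, hxy⟩ := hp.exists_mem_Ico₀ one_pos x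
  exact hxy ▸ hM y (Ico_subset_Icc_self hy)

theorem rpow_le_two_rpow_mul_rpow {t p q : ℝ} (ht : 0 ≤ t) (ht2 : t ≤ 2) (hq : 0 < q)
    (hqp : q ≤ p) : t ^ p ≤ 2 ^ (p - q) * t ^ q := by
  rcases ht.eq_or_lt with rfl | ht
  · simp [Real.zero_rpow hq.ne', Real.zero_rpow (hq.trans_le hqp).ne']
  · calc t ^ p = t ^ (p - q) * t ^ q := by rw [← Real.rpow_add ht]; simp
      _ ≤ 2 ^ (p - q) * t ^ q := by gcongr

theorem abs_deriv_sub_deriv_le_of_contDiff_two {F : ℝ → ℝ} (hF : ContDiff ℝ 2 F)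
    (h1 : ∀ x, F (x + 1) = F x + 1) :
    ∃ C, 0 ≤ C ∧ ∀ x y, |deriv F x - deriv F y| ≤ C * |x - y| := by
  have hd : ContDiff ℝ 1 (deriv F) := ((contDiff_succ_iff_deriv (n := 1)).1 hF).2.2
  have hper : Function.Periodic (deriv (deriv F)) 1 := fun x => by
    rw [← deriv_comp_add_const]
    simp [periodic_deriv_of_map_add_one h1 _]
  obtain ⟨M, hM⟩ := exists_abs_le_of_periodic (hd.continuous_deriv le_rfl) hper
  refine ⟨M, (abs_nonneg _).trans (hM 0), fun x y => ?_⟩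
  exact convex_univ.norm_image_sub_le_of_norm_deriv_le (f := deriv F) (x := y) (y := x)
    (fun z _ => (hd.differentiable one_ne_zero) z) (fun z _ => hM z) (mem_univ _) (mem_univ _)

/-- The derivative of a degree one lift of class `C^r` is locally Hölder continuous with every
exponent `τ ≤ r - 1`. -/
theorem exists_holder_deriv {F : ℝ → ℝ} {r τ : ℝ} (hτ : 0 < τ) (hτ1 : τ < 1) (hτr : τ ≤ r - 1)
    (hF : ContDiff ℝ (⌊r⌋₊ : ℕ) F) (h1 : ∀ x, F (x + 1) = F x + 1)
    (hC : ∃ C : ℝ, ∀ x y : ℝ,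
      |iteratedDeriv ⌊r⌋₊ F x - iteratedDeriv ⌊r⌋₊ F y| ≤ C * |x - y| ^ (r - (⌊r⌋₊ : ℝ))) :
    ∃ C, 0 ≤ C ∧ ∀ x y, |x - y| ≤ 2 → |deriv F x - deriv F y| ≤ C * |x - y| ^ τ := by
  suffices h : ∃ C p : ℝ, 0 ≤ C ∧ τ ≤ p ∧ ∀ x y, |deriv F x - deriv F y| ≤ C * |x - y| ^ p by
    obtain ⟨C, p, hC0, hp, h⟩ := h
    refine ⟨C * 2 ^ (p - τ), by positivity, fun x y hxy => (h x y).trans ?_⟩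
    rw [mul_assoc]
    gcongr
    exact rpow_le_two_rpow_mul_rpow (abs_nonneg _) hxy hτ hp
  rcases lt_or_ge r 2 with hr | hr
  · have hfl : ⌊r⌋₊ = 1 := by
      rw [Nat.floor_eq_iff (by linarith)]
      norm_num
      exact ⟨by linarith, hr⟩
    obtain ⟨C, hC⟩ := hC
    rw [hfl, iteratedDeriv_one] at hC
    refine ⟨|C|, r - 1, abs_nonneg _, hτr, fun x y => (hC x y).trans ?_⟩
    norm_num
    gcongr
    exact le_abs_self C
  · have h2 : (2 : ℕ) ≤ ⌊r⌋₊ := Nat.le_floor (by exact_mod_cast hr)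
    obtain ⟨C, hC0, h⟩ := abs_deriv_sub_deriv_le_of_contDiff_two
      (hF.of_le (by exact_mod_cast h2)) h1
    exact ⟨C, 1, hC0, hτ1.le, by simpa using h⟩

/-- If `F` has positive periodic derivative which is locally Hölder, then `F` changes the ratio of
the lengths of two adjacent intervals by a controlled factor. -/
theorem exists_ratio_distortion {F : ℝ → ℝ} {τ C : ℝ} (hτ : 0 < τ) (hF : ContDiff ℝ 1 F)
    (h1 : ∀ x, F (x + 1) = F x + 1) (hpos : ∀ x, 0 < deriv F x) (hC0 : 0 ≤ C)
    (hC : ∀ x y, |x - y| ≤ 2 → |deriv F x - deriv F y| ≤ C * |x - y| ^ τ) :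
    ∃ K, 0 ≤ K ∧ ∀ a b c, a < b → b < c → c - b ≤ b - a → b - a ≤ 1 →
      (F c - F b) * (b - a) ≤ (c - b) * (F b - F a) * Real.exp (K * (b - a) ^ τ) := by
  have hcont : Continuous (deriv F) := hF.continuous_deriv le_rfl
  have hdiff : Differentiable ℝ F := hF.differentiable one_ne_zero
  obtain ⟨M, hM⟩ := exists_abs_le_of_periodic (g := fun x => (deriv F x)⁻¹)
    (hcont.inv₀ fun x => (hpos x).ne') fun x => by
      simp only [periodic_deriv_of_map_add_one h1 x]
  have hM0 : 0 ≤ M := (abs_nonneg _).trans (hM 0)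
  have hM' : ∀ x, 1 ≤ M * deriv F x := fun x => by
    have := (le_abs_self _).trans (hM x)
    rwa [inv_le_iff_one_le_mul₀ (hpos x)] at this
  -- `M` bounds `1 / F'`, turning the additive Hölder error into a relative one; `2 ^ τ` appears
  -- because the two mean value points are at most `2 * (b - a)` apart.
  refine ⟨C * M * 2 ^ τ, by positivity, fun a b c hab hbc hle h1 => ?_⟩
  obtain ⟨ξ, hξ, hξ'⟩ := exists_deriv_eq_slope F hab hdiff.continuous.continuousOn
    hdiff.differentiableOn
  obtain ⟨ζ, hζ, hζ'⟩ := exists_deriv_eq_slope F hbc hdiff.continuous.continuousOn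
    hdiff.differentiableOn
  have hab' : 0 < b - a := sub_pos.2 hab
  have hbc' : 0 < c - b := sub_pos.2 hbc
  rw [eq_div_iff hab'.ne'] at hξ'
  rw [eq_div_iff hbc'.ne'] at hζ'
  have hd : |ζ - ξ| ≤ 2 * (b - a) := by
    rw [abs_of_pos (by linarith [hξ.2, hζ.1])]
    linarith [hξ.1, hζ.2]
  have hbound : deriv F ζ ≤ deriv F ξ * Real.exp (C * M * 2 ^ τ * (b - a) ^ τ) := by
    calc deriv F ζ ≤ deriv F ξ + C * |ζ - ξ| ^ τ := by
          linarith [le_abs_self (deriv F ζ - deriv F ξ), hC ζ ξ (by linarith)]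
      _ ≤ deriv F ξ + C * (2 * (b - a)) ^ τ := by gcongr
      _ = deriv F ξ + C * 2 ^ τ * (b - a) ^ τ * 1 := by
          rw [Real.mul_rpow zero_le_two hab'.le]; ring
      _ ≤ deriv F ξ + C * 2 ^ τ * (b - a) ^ τ * (M * deriv F ξ) := by gcongr; exact hM' ξ
      _ = deriv F ξ * (C * M * 2 ^ τ * (b - a) ^ τ + 1) := by ring
      _ ≤ _ := by
          have := hpos ξ
          gcongr
          exact Real.add_one_le_exp _
  rw [← hξ', ← hζ']
  calc deriv F ζ * (c - b) * (b - a)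
      ≤ deriv F ξ * Real.exp (C * M * 2 ^ τ * (b - a) ^ τ) * (c - b) * (b - a) := by gcongr
    _ = _ := by ring

/-- A fixed point free circle diffeomorphism of class `C^r`, `r > 1`, has an invertible monotone
degree one lift with controlled distortion. -/
theorem IsCircleDiffeoOfClass.exists_lift {f : UnitAddCircle ≃ UnitAddCircle} {r τ : ℝ}
    (hf : IsCircleDiffeoOfClass r f) (hfix : ∀ x, f x ≠ x)
    (hτ : 0 < τ) (hτ1 : τ < 1) (hτr : τ ≤ r - 1) :
    ∃ u : CircleDeg1Liftˣ, (∀ x : ℝ, ((u x : ℝ) : UnitAddCircle) = f x) ∧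
      ∃ K, 0 ≤ K ∧ ∀ a b c, a < b → b < c → c - b ≤ b - a → b - a ≤ 1 →
        (u c - u b) * (b - a) ≤ (c - b) * (u b - u a) * Real.exp (K * (b - a) ^ τ) := by
  obtain ⟨⟨F, hFl, hFd, hFC⟩, G, hGl, hGd, -⟩ := hf
  have hr1 : (1 : ℕ) ≤ ⌊r⌋₊ := Nat.le_floor (by push_cast; linarith)
  have hF1 : ContDiff ℝ 1 F := hFd.of_le (by exact_mod_cast hr1)
  have hG1 : ContDiff ℝ 1 G := hGd.of_le (by exact_mod_cast hr1)
  have hadd := lift_add_one_of_fixedPointFree hF1.continuous hFl hfix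
  obtain ⟨m, hm⟩ := exists_int_forall_eq_add_of_coe_eq (F := F ∘ G) (G := id)
    (hF1.continuous.comp hG1.continuous) continuous_id fun x => by simp [hFl, hGl]
  obtain ⟨n, hn⟩ := exists_int_forall_eq_add_of_coe_eq (F := G ∘ F) (G := id)
    (hG1.continuous.comp hF1.continuous) continuous_id fun x => by simp [hFl, hGl]
  simp only [Function.comp_apply, id] at hm hn
  have hinj : Function.Injective F := fun x y hxy => by
    have := hn x
    rw [hxy, hn y] at this
    linarith
  have hsurj : Function.Surjective F := fun y => ⟨G (y - m), by rw [hm]; ring⟩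
  have hmono : StrictMono F := by
    refine (hF1.continuous.strictMono_of_inj hinj).resolve_right fun h => ?_
    have h0 := h zero_lt_one
    have h2 := hadd 0
    rw [zero_add] at h2
    linarith
  have hpos : ∀ x, 0 < deriv F x := fun x => by
    refine lt_of_le_of_ne hmono.monotone.deriv_nonneg fun h0 => ?_
    have hc := ((hG1.differentiable one_ne_zero (F x)).hasDerivAt.comp x
      (hF1.differentiable one_ne_zero x).hasDerivAt).congr_of_eventuallyEq
      (f₁ := fun x => x + (n : ℝ)) (Eventually.of_forall fun y => (hn y).symm)
    have := hc.unique ((hasDerivAt_id x).add_const (n : ℝ))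
    simp [← h0] at this
  obtain ⟨C, hC0, hC⟩ := exists_holder_deriv hτ hτ1 hτr hFd hadd hFC
  have hu : IsUnit (⟨⟨F, hmono.monotone⟩, hadd⟩ : CircleDeg1Lift) :=
    CircleDeg1Lift.isUnit_iff_bijective.2 ⟨hinj, hsurj⟩
  obtain ⟨u, hu⟩ := hu
  have hue : ∀ x, u x = F x := fun x => by rw [hu]; rfl
  refine ⟨u, fun x => by rw [hue, hFl], ?_⟩
  simpa only [hue] using exists_ratio_distortion hτ hF1 hadd hpos hC0 hC

/-! ### Cheap lattice paths from the Pólya urn -/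

/-- `LatticePathCost cost v s`: there is a monotone lattice path from `0` to `v` along which the
values of `cost` at the points left behind add up to `s`. -/
inductive LatticePathCost {d : ℕ} (cost : (Fin d → ℕ) → ℝ) : (Fin d → ℕ) → ℝ → Prop
  | zero : LatticePathCost cost 0 0
  | step (v : Fin d → ℕ) (i : Fin d) (s : ℝ) :
      LatticePathCost cost v s → LatticePathCost cost (v + Pi.single i 1) (s + cost v)

/-- The expected cost, along the Pólya urn process, of reaching the point `w` at time `n`. -/
noncomputable def urnCost {d : ℕ} (cost : (Fin d → ℕ) → ℝ) : ℕ → (Fin d → ℕ) → ℝ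
  | 0, _ => 0
  | n + 1, w => ∑ i, (w i : ℝ) / (n + 1) *
      (urnCost cost n (w - Pi.single i 1) + cost (w - Pi.single i 1))

/-- The lattice points of `ℕ^d` with coordinate sum `n`. -/
abbrev latticeLevel (d n : ℕ) : Finset (Fin d → ℕ) := Finset.piAntidiag Finset.univ n

theorem mem_latticeLevel {d n : ℕ} {v : Fin d → ℕ} : v ∈ latticeLevel d n ↔ ∑ i, v i = n := by
  simp [latticeLevel]

theorem sub_single_mem_latticeLevel {d n : ℕ} {w : Fin d → ℕ} (hw : w ∈ latticeLevel d (n + 1))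
    {i : Fin d} (hi : w i ≠ 0) :
    w - Pi.single i 1 ∈ latticeLevel d n ∧ w - Pi.single i 1 + Pi.single i 1 = w := by
  have hle : Pi.single i 1 ≤ w := by
    intro j
    rcases eq_or_ne j i with rfl | hj
    · simpa using Nat.one_le_iff_ne_zero.2 hi
    · simp [hj]
  have hadd : w - Pi.single i 1 + Pi.single i 1 = w := tsub_add_cancel_of_le hle
  refine ⟨?_, hadd⟩
  rw [mem_latticeLevel] at hw ⊢
  rw [← hadd] at hw
  simpa [Finset.sum_add_distrib] using hw

/-- The weights `w i / (n + 1)` form a probability on the predecessors of `w`, so some predecessor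
of positive weight costs no more than the average. -/
theorem exists_latticePathCost_le_urnCost {d : ℕ} (cost : (Fin d → ℕ) → ℝ) (n : ℕ) :
    ∀ v ∈ latticeLevel d n, ∃ s ≤ urnCost cost n v, LatticePathCost cost v s := by
  induction n with
  | zero =>
    intro v hv
    have : v = 0 := by simpa using hv
    exact ⟨0, le_rfl, this ▸ .zero⟩
  | succ n ih =>
    intro w hw
    rw [mem_latticeLevel] at hw
    set g : Fin d → ℝ := fun i => urnCost cost n (w - Pi.single i 1) + cost (w - Pi.single i 1)
    have hw' : ∑ i, (w i : ℝ) = n + 1 := by exact_mod_cast hw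
    obtain ⟨i, hi0, hi⟩ : ∃ i, w i ≠ 0 ∧ g i ≤ urnCost cost (n + 1) w := by
      by_contra! hcon
      have hne : ∃ i, w i ≠ 0 := by
        by_contra! h0
        simp [h0] at hw
      obtain ⟨j, hj⟩ := hne
      have h1 : ∑ i, (w i : ℝ) / (n + 1) * urnCost cost (n + 1) w < ∑ i, (w i : ℝ) / (n + 1) * g i := by
        refine Finset.sum_lt_sum (fun i _ => ?_) ⟨j, Finset.mem_univ _, ?_⟩
        · rcases eq_or_ne (w i) 0 with h0 | h0
          · simp [h0]
          · have := (hcon i h0).le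
            gcongr
        · have := hcon j hj
          have : (0 : ℝ) < w j := by exact_mod_cast Nat.pos_of_ne_zero hj
          gcongr
      rw [← Finset.sum_mul, ← Finset.sum_div, hw', div_self (by positivity), one_mul] at h1
      exact lt_irrefl _ h1
    obtain ⟨hmem, hadd⟩ := sub_single_mem_latticeLevel (mem_latticeLevel.2 hw) hi0
    obtain ⟨s, hs, hp⟩ := ih _ hmem
    refine ⟨s + cost (w - Pi.single i 1), le_trans (by simpa [g] using hs) hi, ?_⟩
    have := hp.step _ i
    rwa [hadd] at this

/-- A point `v` is reached from `v + e_i` with weight `v i + 1`, and these weights add up to `n +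
d`, whatever `v` is. Thus the backward urn step carries the uniform measure on a level to the
uniform measure on the one below. -/
theorem sum_latticeLevel_succ (d n : ℕ) (g : (Fin d → ℕ) → ℝ) :
    ∑ w ∈ latticeLevel d (n + 1), ∑ i, (w i : ℝ) * g (w - Pi.single i 1) =
      (n + d) * ∑ v ∈ latticeLevel d n, g v := by
  have h1 : ∀ i : Fin d, ∑ w ∈ latticeLevel d (n + 1), (w i : ℝ) * g (w - Pi.single i 1) =
      ∑ v ∈ latticeLevel d n, ((v i : ℝ) + 1) * g v := by
    intro i
    symm
    refine Finset.sum_of_injOn (fun v => v + Pi.single i 1) (fun v _ w _ h => by simpa using h)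
      (fun v hv => ?_) (fun w hw hni => ?_) (fun v _ => ?_)
    · simp only [Finset.mem_coe, mem_latticeLevel] at hv ⊢
      simp [Finset.sum_add_distrib, hv]
    · have : w i = 0 := by
        by_contra h0
        obtain ⟨hmem, hadd⟩ := sub_single_mem_latticeLevel hw h0
        exact hni ⟨w - Pi.single i 1, hmem, hadd⟩
      simp [this]
    · simp
  rw [Finset.sum_comm, Finset.sum_congr rfl fun i _ => h1 i, Finset.sum_comm, Finset.mul_sum]
  refine Finset.sum_congr rfl fun v hv => ?_
  rw [mem_latticeLevel] at hv
  rw [← Finset.sum_mul, Finset.sum_add_distrib]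
  congr 1
  simp [← hv]

theorem card_latticeLevel_succ (d n : ℕ) :
    (n + 1 : ℝ) * (latticeLevel d (n + 1)).card = (n + d) * (latticeLevel d n).card := by
  have := sum_latticeLevel_succ d n fun _ => 1
  simp only [mul_one, Finset.sum_const, nsmul_eq_mul] at this
  rw [← this, mul_comm, ← nsmul_eq_mul, ← Finset.sum_const]
  refine Finset.sum_congr rfl fun w hw => ?_
  rw [mem_latticeLevel] at hw
  exact_mod_cast hw.symm

theorem card_latticeLevel (d n : ℕ) :
    ((latticeLevel (d + 1) n).card : ℝ) = (n + d).choose d := by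
  induction n with
  | zero => simp [latticeLevel]
  | succ n ih =>
    have h := card_latticeLevel_succ (d + 1) n
    rw [ih] at h
    have h2 : (n + 1) * (n + 1 + d).choose d = (n + (d + 1)) * (n + d).choose d := by
      have := Nat.add_one_mul_choose_eq (n + d) n
      rw [Nat.choose_symm_of_eq_add (n := n + d) (a := n) (b := d) rfl,
        Nat.choose_symm_of_eq_add (n := n + d + 1) (a := n + 1) (b := d) (by ring)] at this
      rw [show n + 1 + d = n + d + 1 by ring]
      linarith
    have h3 : ((n + 1 : ℕ) : ℝ) * ((n + 1 + d).choose d : ℝ) =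
        ((n + (d + 1) : ℕ) : ℝ) * ((n + d).choose d : ℝ) := by exact_mod_cast h2
    push_cast at h3 h ⊢
    have hn : (n + 1 : ℝ) ≠ 0 := by positivity
    exact mul_left_cancel₀ hn (h.trans h3.symm)

theorem sum_urnCost_div_card (d : ℕ) (cost : (Fin (d + 1) → ℕ) → ℝ) (n : ℕ) :
    (∑ v ∈ latticeLevel (d + 1) n, urnCost cost n v) / (latticeLevel (d + 1) n).card =
      ∑ k ∈ Finset.range n,
        (∑ v ∈ latticeLevel (d + 1) k, cost v) / (latticeLevel (d + 1) k).card := by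
  induction n with
  | zero => simp [urnCost]
  | succ n ih =>
    have hN : ∀ k, (0 : ℝ) < (latticeLevel (d + 1) k).card := fun k => by
      rw [card_latticeLevel]
      exact_mod_cast Nat.choose_pos (by omega)
    rw [Finset.sum_range_succ, ← ih, ← add_div, ← Finset.sum_add_distrib]
    have h1 : ∑ w ∈ latticeLevel (d + 1) (n + 1), urnCost cost (n + 1) w =
        (n + 1 : ℝ)⁻¹ * ((n + (d + 1 : ℕ)) * ∑ v ∈ latticeLevel (d + 1) n,
          (urnCost cost n v + cost v)) := by
      rw [← sum_latticeLevel_succ, Finset.mul_sum]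
      refine Finset.sum_congr rfl fun w _ => ?_
      rw [urnCost, Finset.mul_sum]
      refine Finset.sum_congr rfl fun i _ => ?_
      ring
    have h2 := card_latticeLevel_succ (d + 1) n
    have hn : (0 : ℝ) < n + 1 := by positivity
    rw [h1, div_eq_div_iff (hN _).ne' (hN _).ne']
    field_simp
    rw [mul_right_comm, ← h2]
    ring

/-- The level size is at least `(n + 1) ^ d / d!`, so convergence needs `d * τ / (1 - τ) > 1`, that
is `(d + 1) * τ > 1`. This is the source of the regularity threshold, the rank being `d + 1` here.
-/
theorem summable_card_latticeLevel_rpow {d : ℕ} {τ : ℝ} (hτ1 : τ < 1)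
    (hτ : 1 < (d + 1) * τ) :
    Summable fun n : ℕ => ((latticeLevel (d + 1) n).card : ℝ) ^ (-(τ / (1 - τ))) := by
  have hp : 1 < d * (τ / (1 - τ)) := by
    rw [← mul_div_assoc, one_lt_div (by linarith)]
    linarith
  have hτ0 : 0 < τ := by
    by_contra! h
    nlinarith [show (0 : ℝ) ≤ d + 1 by positivity]
  have hq : 0 < τ / (1 - τ) := div_pos hτ0 (by linarith)
  have hs : Summable fun n : ℕ => ((n + 1 : ℕ) : ℝ) ^ (-(d * (τ / (1 - τ)))) :=
    (summable_nat_add_iff 1).2 (Real.summable_nat_rpow.2 (by linarith))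
  refine Summable.of_nonneg_of_le (fun n => by positivity) (fun n => ?_)
    (hs.mul_left ((d.factorial : ℝ) ^ (τ / (1 - τ))))
  have hbase : ((n + 1 : ℕ) : ℝ) ^ d / d.factorial ≤ (latticeLevel (d + 1) n).card := by
    rw [card_latticeLevel]
    have := Nat.pow_le_choose (α := ℝ) d (n + d)
    rwa [show n + d + 1 - d = n + 1 by omega] at this
  have hpos : 0 < ((n + 1 : ℕ) : ℝ) ^ d / d.factorial := by positivity
  calc ((latticeLevel (d + 1) n).card : ℝ) ^ (-(τ / (1 - τ)))
      ≤ (((n + 1 : ℕ) : ℝ) ^ d / d.factorial) ^ (-(τ / (1 - τ))) :=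
        Real.rpow_le_rpow_of_nonpos hpos hbase (by linarith)
    _ = _ := by
        rw [Real.div_rpow (by positivity) (by positivity), ← Real.rpow_natCast,
          ← Real.rpow_mul (by positivity), Real.rpow_neg (x := (d.factorial : ℝ)) (by positivity)]
        rw [div_inv_eq_mul, mul_comm]
        ring_nf

/-- Weighted AM-GM for `l` and `N ^ (-1 / (1 - τ))`. Summed over a level of `N` points, the last
term gives the general term of the convergent series above. -/
theorem rpow_div_le {l N τ : ℝ} (hl : 0 ≤ l) (hN : 0 < N) (hτ : 0 < τ) (hτ1 : τ < 1) :
    l ^ τ / N ≤ τ * l + (1 - τ) * (N ^ (-(τ / (1 - τ))) / N) := by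
  have h1 : 1 - τ ≠ 0 := by linarith
  have h := Real.geom_mean_le_arith_mean2_weighted hτ.le (by linarith : 0 ≤ 1 - τ) hl
    (Real.rpow_nonneg hN.le (-(1 / (1 - τ)))) (by ring)
  rw [← Real.rpow_mul hN.le, neg_mul, one_div_mul_cancel h1, Real.rpow_neg_one,
    ← div_eq_mul_inv] at h
  rwa [← Real.rpow_sub_one hN.ne', show -(τ / (1 - τ)) - 1 = -(1 / (1 - τ)) by field_simp; ring]

/-- Monotone lattice paths of bounded `τ`-cost, for a summable family of lengths and `τ > 1 / d`. -/
theorem exists_latticePathCost_bounded {d : ℕ} {τ : ℝ} (hτ : 0 < τ) (hτ1 : τ < 1)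
    (hτd : 1 < d * τ) {l : (Fin d → ℕ) → ℝ} (hl0 : ∀ v, 0 ≤ l v) (hl : Summable l) :
    ∃ S, ∀ n, ∃ v ∈ latticeLevel d n, ∃ s ≤ S, LatticePathCost (fun v => l v ^ τ) v s := by
  obtain _ | d := d
  · norm_num at hτd
  push_cast at hτd
  have hN : ∀ k, (0 : ℝ) < (latticeLevel (d + 1) k).card := fun k => by
    rw [card_latticeLevel]
    exact_mod_cast Nat.choose_pos (by omega)
  have hsum := summable_card_latticeLevel_rpow hτ1 hτd
  set q := fun n : ℕ => ((latticeLevel (d + 1) n).card : ℝ) ^ (-(τ / (1 - τ))) with hq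
  refine ⟨τ * ∑' v, l v + (1 - τ) * ∑' n, q n, fun n => ?_⟩
  have hlevel : ∑ k ∈ Finset.range n, ∑ v ∈ latticeLevel (d + 1) k, l v ≤ ∑' v, l v := by
    rw [← Finset.sum_biUnion]
    · exact hl.sum_le_tsum _ fun v _ => hl0 v
    · intro i _ j _ hij
      refine Finset.disjoint_left.2 fun v hi hj => hij ?_
      rw [mem_latticeLevel] at hi hj
      rw [← hi, ← hj]
  have hk : ∀ k, (∑ v ∈ latticeLevel (d + 1) k, l v ^ τ) / (latticeLevel (d + 1) k).card ≤
      τ * ∑ v ∈ latticeLevel (d + 1) k, l v + (1 - τ) * q k := fun k => by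
    rw [Finset.sum_div]
    refine (Finset.sum_le_sum fun v _ => rpow_div_le (hl0 v) (hN k) hτ hτ1).trans_eq ?_
    rw [Finset.sum_add_distrib, ← Finset.mul_sum, Finset.sum_const, nsmul_eq_mul]
    have := (hN k).ne'
    simp only [hq]
    field_simp
  have havg : (∑ v ∈ latticeLevel (d + 1) n, urnCost (fun v => l v ^ τ) n v) /
      (latticeLevel (d + 1) n).card ≤ τ * ∑' v, l v + (1 - τ) * ∑' n, q n := by
    rw [sum_urnCost_div_card]
    refine (Finset.sum_le_sum fun k _ => hk k).trans ?_
    rw [Finset.sum_add_distrib, ← Finset.mul_sum, ← Finset.mul_sum]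
    have : ∑ k ∈ Finset.range n, q k ≤ ∑' n, q n :=
      hsum.sum_le_tsum _ fun k _ => by positivity
    have : 0 ≤ 1 - τ := by linarith
    gcongr
  rw [div_le_iff₀ (hN n), mul_comm, ← nsmul_eq_mul, ← Finset.sum_const] at havg
  obtain ⟨v, hv, hle⟩ := Finset.exists_le_of_sum_le
    (Finset.card_pos.1 (by exact_mod_cast hN n)) havg
  obtain ⟨s, hs, hp⟩ := exists_latticePathCost_le_urnCost _ n v hv
  exact ⟨v, hv, s, hs.trans hle, hp⟩

/-! ### Uniform return times of irrational rotations -/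

/-- Dirichlet approximation gives a nonzero step `β` with `|β| < η`, too short to jump over the
window. Uniformity in `x` allows `N` to be fixed before the endpoint of the lattice path is known.
-/
theorem exists_nat_forall_add_mul_mem_Ioo {α : ℝ} (hα : Irrational α) {η : ℝ} (hη : 0 < η) :
    ∃ N : ℕ, ∀ x : ℝ, ∃ k ≤ N, ∃ m : ℤ, x + k * α + m ∈ Ioo 0 η := by
  obtain ⟨n, hn⟩ := exists_nat_one_div_lt hη
  obtain ⟨j, k, hk, -, hjk⟩ := Real.exists_int_int_abs_mul_sub_le α n.succ_pos
  lift k to ℕ using hk.le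
  have hk0 : k ≠ 0 := by
    rintro rfl
    simp at hk
  set β := (k : ℝ) * α - j with hβ
  have hsmall : |β| < η := by
    refine lt_of_le_of_lt ?_ hn
    refine (by simpa using hjk : |β| ≤ _).trans ?_
    rw [one_div]
    gcongr
    linarith
  have hβ0 : β ≠ 0 := ((hα.natCast_mul hk0).sub_intCast j).ne_zero
  refine ⟨⌊2 / |β| + 1⌋₊ * k, fun x => ?_⟩
  have hfr := Int.fract_add_floor x
  have hf0 := Int.fract_nonneg x
  have hf1 := Int.fract_lt_one x
  have hab : 0 < |β| := abs_pos.2 hβ0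
  rcases hβ0.lt_or_gt with hneg | hpos
  · rw [abs_of_neg hneg] at hab hsmall ⊢
    -- The last step before the descent from `fract x + 1` reaches zero; `ceil - 1` keeps the value
    -- strictly positive.
    set i := ⌈(Int.fract x + 1) / (-β)⌉₊ - 1 with hi
    have hc : 0 < ⌈(Int.fract x + 1) / (-β)⌉₊ := Nat.ceil_pos.2 (by positivity)
    have hi' : (i : ℝ) + 1 = ⌈(Int.fract x + 1) / (-β)⌉₊ := by
      exact_mod_cast Nat.sub_add_cancel hc
    have h1 : (Int.fract x + 1) / (-β) ≤ i + 1 := hi' ▸ Nat.le_ceil _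
    have h2 : (i : ℝ) < (Int.fract x + 1) / (-β) := by
      have := Nat.ceil_lt_add_one (a := (Int.fract x + 1) / (-β)) (by positivity)
      linarith
    rw [div_le_iff₀ hab] at h1
    have h3 : (i : ℝ) ≤ 2 / (-β) + 1 := by
      have : (Int.fract x + 1) / (-β) ≤ 2 / (-β) := by gcongr; linarith
      linarith
    rw [lt_div_iff₀ hab] at h2
    refine ⟨i * k, Nat.mul_le_mul_right k (Nat.le_floor h3), -⌊x⌋ + 1 - i * j, ?_⟩
    have : x + ((i * k : ℕ) : ℝ) * α + ((-⌊x⌋ + 1 - i * j : ℤ) : ℝ) =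
        Int.fract x + 1 + i * β := by
      push_cast
      rw [hβ]
      linear_combination -hfr
    rw [this]
    constructor <;> linarith
  · rw [abs_of_pos hpos] at hab hsmall ⊢
    set i := ⌊(1 - Int.fract x) / β⌋₊ + 1 with hi
    have h1 : (1 - Int.fract x) / β < i := by
      rw [hi]
      exact_mod_cast Nat.lt_floor_add_one _
    have h2 : (i : ℝ) ≤ (1 - Int.fract x) / β + 1 := by
      have := Nat.floor_le (a := (1 - Int.fract x) / β) (div_nonneg (by linarith) hab.le)
      rw [hi]
      push_cast
      linarith
    have h3 : (i : ℝ) ≤ 2 / β + 1 := by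
      have : (1 - Int.fract x) / β ≤ 2 / β := by gcongr; linarith
      linarith
    rw [div_lt_iff₀ hab] at h1
    have h4 : (i : ℝ) * β ≤ 1 - Int.fract x + β := by
      calc (i : ℝ) * β ≤ ((1 - Int.fract x) / β + 1) * β := by gcongr
        _ = _ := by field_simp
    refine ⟨i * k, Nat.mul_le_mul_right k (Nat.le_floor h3), -⌊x⌋ - 1 - i * j, ?_⟩
    have : x + ((i * k : ℕ) : ℝ) * α + ((-⌊x⌋ - 1 - i * j : ℤ) : ℝ) =
        Int.fract x - 1 + i * β := by
      push_cast
      rw [hβ]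
      linear_combination -hfr
    rw [this]
    constructor <;> linarith

-- The group of lifts and its semiconjugacy to translations

local notation "τ" => CircleDeg1Lift.translationNumber

section Lifts

variable {Γ : Type*} [AddCommGroup Γ] [AddAction Γ UnitAddCircle]

/-- `u` is a lift to the line of the action of `n` on the circle. -/
def IsLiftOf (n : Γ) (u : CircleDeg1Liftˣ) : Prop :=
  ∀ x : ℝ, ((u x : ℝ) : UnitAddCircle) = n +ᵥ (x : UnitAddCircle)

theorem CircleDeg1Lift.units_continuous (u : CircleDeg1Liftˣ) : Continuous u := by
  rw [← CircleDeg1Lift.coe_toOrderIso]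
  exact (CircleDeg1Lift.toOrderIso u).continuous

namespace IsLiftOf

variable {n m : Γ} {u v : CircleDeg1Liftˣ}

theorem mul (hu : IsLiftOf n u) (hv : IsLiftOf m v) : IsLiftOf (n + m) (u * v) := fun x => by
  rw [Units.val_mul, CircleDeg1Lift.mul_apply, hu, hv, add_vadd]

theorem one : IsLiftOf (0 : Γ) 1 := fun x => by simp

theorem inv (hu : IsLiftOf n u) : IsLiftOf (-n) u⁻¹ := fun x => by
  rw [eq_neg_vadd_iff, ← hu, CircleDeg1Lift.units_apply_inv_apply]

theorem pow (hu : IsLiftOf n u) (k : ℕ) : IsLiftOf (k • n) (u ^ k) := by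
  induction k with
  | zero => simpa using one
  | succ k ih => rw [pow_succ, succ_nsmul]; exact ih.mul hu

theorem exists_int_eq_add (hu : IsLiftOf n u) (hv : IsLiftOf n v) :
    ∃ k : ℤ, ∀ x, u x = v x + k :=
  exists_int_forall_eq_add_of_coe_eq (CircleDeg1Lift.units_continuous u)
    (CircleDeg1Lift.units_continuous v) fun x => by rw [hu, hv]

theorem eq_zero_of_apply_eq (hfree : IsFreeAddAction Γ UnitAddCircle) (hu : IsLiftOf n u)
    {x : ℝ} {k : ℤ} (h : u x = x + k) : n = 0 := by
  refine hfree n x ?_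
  rw [← hu, unitAddCircle_coe_eq_coe_iff]
  exact ⟨k, h⟩

theorem eq_zero_of_translationNumber_eq (hfree : IsFreeAddAction Γ UnitAddCircle)
    (hu : IsLiftOf n u) {k : ℤ} (h : τ u = k) : n = 0 := by
  obtain ⟨x, hx⟩ := (CircleDeg1Lift.translationNumber_eq_int_iff _
    (CircleDeg1Lift.units_continuous u)).1 h
  exact hu.eq_zero_of_apply_eq hfree hx

theorem irrational (hfree : IsFreeAddAction Γ UnitAddCircle) (hu : IsLiftOf n u)
    (hn : ∀ k : ℕ, 0 < k → k • n ≠ 0) : Irrational (τ u) := by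
  rintro ⟨q, hq⟩
  refine hn q.den q.pos ((hu.pow q.den).eq_zero_of_translationNumber_eq hfree (k := q.num) ?_)
  rw [Units.val_pow_eq_pow_val, CircleDeg1Lift.translationNumber_pow, ← hq, mul_comm]
  exact_mod_cast Rat.mul_den_eq_num q

/-- Conjugating `v` by `u` gives another lift of `m`, hence `v` plus an integer; conjugation
invariance of the translation number makes this integer zero. -/
theorem commute (hu : IsLiftOf n u) (hv : IsLiftOf m v) : Commute u v := by
  have hconj : IsLiftOf m (u * v * u⁻¹) := by simpa using (hu.mul hv).mul hu.inv
  obtain ⟨k, hk⟩ := hconj.exists_int_eq_add hv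
  have hmul : u * v * u⁻¹ = CircleDeg1Lift.translate (Multiplicative.ofAdd (k : ℝ)) * v := by
    ext x
    rw [hk, Units.val_mul, CircleDeg1Lift.mul_apply, CircleDeg1Lift.translate_apply, add_comm]
  have hcomm : Commute
      (CircleDeg1Lift.translate (Multiplicative.ofAdd (k : ℝ)) : CircleDeg1Lift) v := by
    rw [CircleDeg1Lift.commute_iff_commute]
    intro x
    simp
  have h := congrArg (fun w : CircleDeg1Liftˣ => τ w) hmul
  simp only [Units.val_mul, CircleDeg1Lift.translationNumber_conj_eq,
    CircleDeg1Lift.translationNumber_mul_of_commute hcomm,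
    CircleDeg1Lift.translationNumber_translate] at h
  have hk0 : (k : ℝ) = 0 := by linarith
  rw [hk0, ofAdd_zero, map_one, one_mul] at hmul
  exact mul_inv_eq_iff_eq_mul.1 hmul

theorem translationNumber_mul (hu : IsLiftOf n u) (hv : IsLiftOf m v) :
    τ (u * v : CircleDeg1Liftˣ) = τ u + τ v := by
  rw [Units.val_mul]
  exact CircleDeg1Lift.translationNumber_mul_of_commute ((hu.commute hv).map (Units.coeHom _))

end IsLiftOf

/-- The group of all lifts of elements of the acting group. -/
def liftSubgroup (Γ : Type*) [AddCommGroup Γ] [AddAction Γ UnitAddCircle] :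
    Subgroup CircleDeg1Liftˣ where
  carrier := {u | ∃ n : Γ, IsLiftOf n u}
  mul_mem' := fun ⟨_, hu⟩ ⟨_, hv⟩ => ⟨_, hu.mul hv⟩
  one_mem' := ⟨0, .one⟩
  inv_mem' := fun ⟨_, hu⟩ => ⟨_, hu.inv⟩

/-- The lifts of an action of an abelian group are simultaneously semiconjugate to translations. -/
theorem exists_semiconj_translationNumber (Γ : Type*) [AddCommGroup Γ]
    [AddAction Γ UnitAddCircle] :
    ∃ h : CircleDeg1Lift, ∀ (n : Γ) (u : CircleDeg1Liftˣ), IsLiftOf n u →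
      ∀ x, h (u x) = h x + τ u := by
  let f₁ : liftSubgroup Γ →* CircleDeg1Lift := (Units.coeHom _).comp (liftSubgroup Γ).subtype
  let rot : liftSubgroup Γ →* Multiplicative ℝ :=
    { toFun := fun u => Multiplicative.ofAdd (τ (u : CircleDeg1Liftˣ))
      map_one' := by simp
      map_mul' := by
        rintro ⟨u, n, hu⟩ ⟨v, m, hv⟩
        rw [← ofAdd_add, ← hu.translationNumber_mul hv]
        rfl }
  let f₂ : liftSubgroup Γ →* CircleDeg1Lift :=
    (Units.coeHom _).comp (CircleDeg1Lift.translate.comp rot)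
  obtain ⟨h, hh⟩ := CircleDeg1Lift.semiconj_of_group_action_of_forall_translationNumber_eq f₁ f₂
    fun u => (CircleDeg1Lift.translationNumber_translate _).symm
  refine ⟨h, fun n u hu x => ?_⟩
  have := hh ⟨u, n, hu⟩ x
  refine this.trans ((CircleDeg1Lift.translate_apply _ _).trans (add_comm _ _))

theorem CircleDeg1Lift.pow_semiconj {h : CircleDeg1Lift} {u : CircleDeg1Lift} {t : ℝ}
    (hu : ∀ x, h (u x) = h x + t) (k : ℕ) (x : ℝ) : h ((u ^ k) x) = h x + k * t := by
  induction k with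
  | zero => simp
  | succ k ih =>
    rw [pow_succ', CircleDeg1Lift.mul_apply, hu, ih]
    push_cast
    ring

/-- A semiconjugacy to an irrational translation is continuous. -/
theorem CircleDeg1Lift.continuous_of_semiconj_irrational {h u : CircleDeg1Lift} {t : ℝ}
    (ht : Irrational t) (hu : ∀ x, h (u x) = h x + t) : Continuous h := by
  refine h.monotone.continuous_of_denseRange (dense_iff_exists_between.2 fun p q hpq => ?_)
  obtain ⟨N, hN⟩ := exists_nat_forall_add_mul_mem_Ioo ht (sub_pos.2 hpq)
  obtain ⟨k, -, m, hm⟩ := hN (h 0 - p)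
  refine ⟨_, ⟨(u ^ k) 0 + m, rfl⟩, ?_⟩
  rw [CircleDeg1Lift.map_add_int, CircleDeg1Lift.pow_semiconj hu]
  constructor <;> linarith [hm.1, hm.2]

/-- An action with a lift conjugate to an irrational translation is minimal. -/
theorem isMinimal_of_semiconj_irrational {h : CircleDeg1Lift} {n : Γ} {u : CircleDeg1Liftˣ} {t : ℝ}
    (hinj : StrictMono h) (hn : IsLiftOf n u) (ht : Irrational t) (hu : ∀ x, h (u x) = h x + t) :
    AddAction.IsMinimal Γ UnitAddCircle := by
  refine ⟨fun x => ?_⟩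
  induction x using QuotientAddGroup.induction_on with | H x => ?_
  have hd : DenseRange fun p : ℕ × ℤ => (u ^ p.1 : CircleDeg1Liftˣ) x + p.2 := by
    refine dense_iff_exists_between.2 fun p q hpq => ?_
    obtain ⟨N, hN⟩ := exists_nat_forall_add_mul_mem_Ioo ht (sub_pos.2 (hinj hpq))
    obtain ⟨k, -, m, hm⟩ := hN (h x - h p)
    have hval : h ((u ^ k : CircleDeg1Liftˣ) x + m) = h x + k * t + m := by
      rw [CircleDeg1Lift.map_add_int, Units.val_pow_eq_pow_val, CircleDeg1Lift.pow_semiconj hu]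
    refine ⟨_, ⟨(k, m), rfl⟩, hinj.lt_iff_lt.1 ?_, hinj.lt_iff_lt.1 ?_⟩ <;>
      linarith [hm.1, hm.2]
  have hd' : DenseRange fun p : ℕ × ℤ =>
      (((u ^ p.1 : CircleDeg1Liftˣ) x + p.2 : ℝ) : UnitAddCircle) :=
    (QuotientAddGroup.mk_surjective.denseRange).comp hd (AddCircle.continuous_mk' 1)
  refine hd'.mono ?_
  rintro _ ⟨⟨k, m⟩, rfl⟩
  refine ⟨k • n, ?_⟩
  change k • n +ᵥ (x : UnitAddCircle) = _
  rw [← hn.pow k, unitAddCircle_coe_eq_coe_iff]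
  exact ⟨-m, by simp⟩

/-- The images of an interval collapsed by the semiconjugacy have summable lengths. -/
theorem summable_lift_sub {ι : Type*} (hfree : IsFreeAddAction Γ UnitAddCircle) {h : CircleDeg1Lift}
    (hh : ∀ (n : Γ) (u : CircleDeg1Liftˣ), IsLiftOf n u → ∀ x, h (u x) = h x + τ u)
    {n : ι → Γ} (hn : Function.Injective n) {E : ι → CircleDeg1Liftˣ}
    (hE : ∀ i, IsLiftOf (n i) (E i)) {a b : ℝ} (hab : a < b) (heq : h a = h b) :
    Summable fun i => E i b - E i a := by
  have hb1 : b ≤ a + 1 := by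
    by_contra! hlt
    have := h.monotone hlt.le
    rw [CircleDeg1Lift.map_add_one] at this
    linarith
  have hle : ∀ i, E i a ≤ E i b := fun i => (E i).val.monotone hab.le
  refine summable_of_sum_le (c := 2) (fun i => sub_nonneg.2 (hle i)) fun s => ?_
  -- Integer shifts bring all images into `(0, 2)`. Since `h` is constant on each, an overlap makes
  -- two translation numbers differ by an integer, which freeness forbids for distinct elements.
  set J : ι → Set ℝ := fun i => Ioo (E i a - ⌊E i a⌋) (E i b - ⌊E i a⌋) with hJ
  have hvol : ∀ i, MeasureTheory.volume.real (J i) = E i b - E i a := fun i => by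
    rw [hJ, Real.volume_real_Ioo_of_le (by linarith [hle i])]
    ring
  have hsub : ∀ i, J i ⊆ Ioo 0 2 := fun i z hz => by
    have h1 := (E i).val.monotone hb1
    rw [CircleDeg1Lift.map_add_one] at h1
    have h2 := Int.floor_le (E i a)
    have h3 := Int.lt_floor_add_one (E i a)
    constructor <;> linarith [hz.1, hz.2]
  have hval : ∀ i, ∀ z ∈ J i, h z = h a + τ (E i) - ⌊E i a⌋ := fun i z hz => by
    have h1 := h.monotone hz.1.le
    have h2 := h.monotone hz.2.le
    rw [CircleDeg1Lift.map_sub_int, hh _ _ (hE i)] at h1 h2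
    linarith
  have hdisj : (s : Set ι).PairwiseDisjoint J := fun i _ j _ hij => by
    refine disjoint_left.2 fun z hi hj => hij (hn ?_)
    have hz := (hval i z hi).symm.trans (hval j z hj)
    have h0 := ((hE i).mul (hE j).inv).eq_zero_of_translationNumber_eq hfree
      (k := ⌊E i a⌋ - ⌊E j a⌋) (by
        rw [(hE i).translationNumber_mul (hE j).inv, CircleDeg1Lift.translationNumber_units_inv]
        push_cast
        linarith)
    rwa [← sub_eq_add_neg, sub_eq_zero] at h0
  calc ∑ i ∈ s, (E i b - E i a) = MeasureTheory.volume.real (⋃ i ∈ s, J i) := by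
        rw [MeasureTheory.measureReal_biUnion_finset hdisj (fun i _ => measurableSet_Ioo)
          fun i _ => measure_Ioo_lt_top.ne]
        exact Finset.sum_congr rfl fun i _ => (hvol i).symm
    _ ≤ MeasureTheory.volume.real (Ioo (0 : ℝ) 2) :=
        MeasureTheory.measureReal_mono (iUnion₂_subset fun i _ => hsub i) (by simp)
    _ = 2 := by rw [Real.volume_real_Ioo_of_le (by norm_num)]; norm_num

end Lifts

/-! ### Excluding collapsed intervals -/

theorem CircleDeg1Lift.units_strictMono (u : CircleDeg1Liftˣ) : StrictMono u := by
  rw [← CircleDeg1Lift.coe_toOrderIso]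
  exact (CircleDeg1Lift.toOrderIso u).strictMono

/-- A lattice path can be prolonged along an axis at a cost controlled by the maximum of the cost
function beyond its endpoint. -/
theorem LatticePathCost.add_nsmul_single {d : ℕ} {cost : (Fin d → ℕ) → ℝ} {v : Fin d → ℕ} {s δ : ℝ}
    (hp : LatticePathCost cost v s) (i : Fin d) (hδ : ∀ w, v ≤ w → cost w ≤ δ) (k : ℕ) :
    ∃ s' ≤ s + k * δ, LatticePathCost cost (v + k • Pi.single i 1) s' := by
  induction k with
  | zero => exact ⟨s, by simp, by simpa using hp⟩
  | succ k ih =>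
    obtain ⟨s', hs', hp'⟩ := ih
    refine ⟨s' + cost (v + k • Pi.single i 1), ?_, ?_⟩
    · have := hδ (v + k • Pi.single i 1) (by simp)
      push_cast
      linarith
    · rw [succ_nsmul, ← add_assoc]
      exact hp'.step _ i

section

variable {d : ℕ} [AddAction (Fin d → ℤ) UnitAddCircle]

/-- Along a lattice path of bounded cost the images of two adjacent intervals have comparable
lengths. -/
theorem LatticePathCost.ratio_le {E : (Fin d → ℕ) → CircleDeg1Liftˣ}
    (hE : ∀ v, IsLiftOf (fun j => (v j : ℤ)) (E v)) (hE0 : E 0 = 1)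
    {u : Fin d → CircleDeg1Liftˣ} (hu : ∀ i, IsLiftOf (Pi.single i 1 : Fin d → ℤ) (u i))
    {K σ : ℝ} (hK : 0 ≤ K)
    (hratio : ∀ i a b c, a < b → b < c → c - b ≤ b - a → b - a ≤ 1 →
        (u i c - u i b) * (b - a) ≤ (c - b) * (u i b - u i a) * Real.exp (K * (b - a) ^ σ))
    {a b c S : ℝ} (hab : a < b) (hbc : b < c) (hlen : ∀ v, E v b - E v a ≤ 1)
    (hS : (c - b) * Real.exp (K * S) ≤ b - a) {v : Fin d → ℕ} {s : ℝ}
    (hp : LatticePathCost (fun v => (E v b - E v a) ^ σ) v s) (hs : s ≤ S) :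
    (E v c - E v b) * (b - a) ≤ (c - b) * (E v b - E v a) * Real.exp (K * s) := by
  have hmono : ∀ v, E v a < E v b ∧ E v b < E v c := fun v =>
    ⟨CircleDeg1Lift.units_strictMono _ hab, CircleDeg1Lift.units_strictMono _ hbc⟩
  have hab' : 0 < b - a := sub_pos.2 hab
  have hbc' : 0 < c - b := sub_pos.2 hbc
  induction hp with
  | zero => simp [hE0]
  | step v i s hp ih =>
    have hcost : 0 ≤ (E v b - E v a) ^ σ := Real.rpow_nonneg (by linarith [(hmono v).1]) _
    have hsS : s ≤ S := by linarith
    have ih := ih hsS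
    have hpos : 0 < E v b - E v a := sub_pos.2 (hmono v).1
    -- The induction must also keep the right interval the shorter one, as the one-step estimate
    -- requires; the bound `hS` on its initial length ensures this.
    have hle : E v c - E v b ≤ E v b - E v a := by
      refine le_of_mul_le_mul_right (ih.trans ?_) hab'
      calc (c - b) * (E v b - E v a) * Real.exp (K * s)
          ≤ (c - b) * (E v b - E v a) * Real.exp (K * S) := by gcongr
        _ = (E v b - E v a) * ((c - b) * Real.exp (K * S)) := by ring
        _ ≤ (E v b - E v a) * (b - a) := by gcongr
    have hr := hratio i _ _ _ (hmono v).1 (hmono v).2 hle (hlen v)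
    have hlift : IsLiftOf (fun j => (((v + Pi.single i 1 : Fin d → ℕ) j : ℕ) : ℤ)) (u i * E v) := by
      have : (fun j => (((v + Pi.single i 1 : Fin d → ℕ) j : ℕ) : ℤ)) =
          (Pi.single i 1 : Fin d → ℤ) + fun j => (v j : ℤ) := by
        ext j
        rcases eq_or_ne j i with rfl | hj
        · simp [add_comm]
        · simp [hj]
      rw [this]
      exact (hu i).mul (hE v)
    obtain ⟨m, hm⟩ := (hE (v + Pi.single i 1)).exists_int_eq_add hlift
    simp only [Units.val_mul, CircleDeg1Lift.mul_apply] at hm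
    simp only [hm, add_sub_add_right_eq_sub]
    have hupos : 0 < u i (E v b) - u i (E v a) :=
      sub_pos.2 (CircleDeg1Lift.units_strictMono _ (hmono v).1)
    refine le_of_mul_le_mul_right ?_ hpos
    rw [mul_add, Real.exp_add]
    calc (u i (E v c) - u i (E v b)) * (b - a) * (E v b - E v a)
        = (u i (E v c) - u i (E v b)) * (E v b - E v a) * (b - a) := by ring
      _ ≤ (E v c - E v b) * (u i (E v b) - u i (E v a)) *
          Real.exp (K * (E v b - E v a) ^ σ) * (b - a) := by gcongr
      _ = (E v c - E v b) * (b - a) * ((u i (E v b) - u i (E v a)) *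
          Real.exp (K * (E v b - E v a) ^ σ)) := by ring
      _ ≤ (c - b) * (E v b - E v a) * Real.exp (K * s) * ((u i (E v b) - u i (E v a)) *
          Real.exp (K * (E v b - E v a) ^ σ)) := by gcongr
      _ = _ := by ring

/-- A semiconjugacy of a free `ℤ^d`-action with controlled distortion to a group of rotations
collapses no interval. -/
theorem strictMono_of_ratio_distortion (hfree : IsFreeAddAction (Fin d → ℤ) UnitAddCircle)
    {h : CircleDeg1Lift}
    (hh : ∀ (n : Fin d → ℤ) (u : CircleDeg1Liftˣ), IsLiftOf n u → ∀ x, h (u x) = h x + τ u)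
    (hcont : Continuous h) (hlift : ∀ n : Fin d → ℤ, ∃ u, IsLiftOf n u)
    {u : Fin d → CircleDeg1Liftˣ} (hu : ∀ i, IsLiftOf (Pi.single i 1 : Fin d → ℤ) (u i))
    (i₀ : Fin d) (hirr : Irrational (τ (u i₀)))
    {K σ : ℝ} (hσ : 0 < σ) (hσ1 : σ < 1) (hσd : 1 < d * σ) (hK : 0 ≤ K)
    (hratio : ∀ i a b c, a < b → b < c → c - b ≤ b - a → b - a ≤ 1 →
        (u i c - u i b) * (b - a) ≤ (c - b) * (u i b - u i a) * Real.exp (K * (b - a) ^ σ)) :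
    StrictMono h := by
  by_contra hns
  obtain ⟨a, q, haq, hqa⟩ : ∃ a q, a < q ∧ h q ≤ h a := by
    simpa [StrictMono] using hns
  have hbdd : BddAbove {x | h x = h a} := ⟨a + 1, fun x (hx : h x = h a) => by
    by_contra! hlt
    have := h.monotone hlt.le
    rw [CircleDeg1Lift.map_add_one] at this
    linarith⟩
  have hclosed : IsClosed {x | h x = h a} := isClosed_eq hcont continuous_const
  set b := sSup {x | h x = h a} with hb
  have hbmem : h b = h a := hclosed.csSup_mem ⟨a, rfl⟩ hbdd
  have hbmax : ∀ x, b < x → h b < h x := fun x hx => by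
    refine lt_of_le_of_ne (h.monotone hx.le) fun heq => hx.not_ge (le_csSup hbdd ?_)
    exact heq.symm.trans hbmem
  have hab : a < b := haq.trans_le
    (le_csSup hbdd (le_antisymm hqa (h.monotone haq.le)))
  obtain ⟨E, hE, hE0⟩ : ∃ E : (Fin d → ℕ) → CircleDeg1Liftˣ,
      (∀ v, IsLiftOf (fun j => (v j : ℤ)) (E v)) ∧ E 0 = 1 := by
    choose E hE using fun v : Fin d → ℕ => hlift fun j => (v j : ℤ)
    refine ⟨Function.update E 0 1, fun v => ?_, by simp⟩
    rcases eq_or_ne v 0 with rfl | hv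
    · have h0 : (fun j => (((0 : Fin d → ℕ) j : ℕ) : ℤ)) = 0 := by ext; simp
      rw [h0]
      simpa using IsLiftOf.one
    · simpa [hv] using hE v
  have hinj : Function.Injective fun (v : Fin d → ℕ) (j : Fin d) => (v j : ℤ) := fun v w hvw => by
    ext j
    exact Nat.cast_injective (congrFun hvw j)
  set l : (Fin d → ℕ) → ℝ := fun v => E v b - E v a with hl
  have hl0 : ∀ v, 0 < l v := fun v => sub_pos.2 (CircleDeg1Lift.units_strictMono _ hab)
  have hl1 : ∀ v, l v ≤ 1 := fun v => by
    have := (E v).val.monotone (show b ≤ a + 1 from csSup_le ⟨a, rfl⟩ fun x (hx : h x = h a) => by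
      by_contra! hlt
      have := h.monotone hlt.le
      rw [CircleDeg1Lift.map_add_one] at this
      linarith)
    rw [CircleDeg1Lift.map_add_one] at this
    simp only [hl]
    linarith
  have hsum : Summable l := summable_lift_sub hfree hh hinj hE hab hbmem.symm
  obtain ⟨S, hS⟩ := exists_latticePathCost_bounded hσ hσ1 hσd (fun v => (hl0 v).le) hsum
  -- The cost budget is `S` for the path and `1` for its prolongation, at most `N` steps of cost at
  -- most `1 / (N + 1)`.
  set δ := (b - a) * Real.exp (-(K * (S + 1))) with hδ
  have hδ0 : 0 < δ := mul_pos (sub_pos.2 hab) (Real.exp_pos _)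
  have hδS : (b + δ - b) * Real.exp (K * (S + 1)) ≤ b - a := by
    rw [add_sub_cancel_left, hδ, mul_assoc, ← Real.exp_add]
    simp
  obtain ⟨N, hN⟩ := exists_nat_forall_add_mul_mem_Ioo hirr
    (sub_pos.2 (hbmax (b + δ / 2) (by linarith)))
  obtain ⟨n, hn0, hn⟩ : ∃ n, 0 < n ∧ ∀ w : Fin d → ℕ, n ≤ ∑ i, w i →
      l w < δ / 2 ∧ l w ^ σ ≤ 1 / (N + 1) := by
    have hlim := hsum.tendsto_cofinite_zero
    have hlim' : Tendsto (fun w => l w ^ σ) cofinite (𝓝 0) := by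
      simpa [Real.zero_rpow hσ.ne'] using hlim.rpow_const (p := σ) (Or.inr hσ.le)
    have hev : ∀ᶠ w in cofinite, l w < δ / 2 ∧ l w ^ σ ≤ 1 / (N + 1) :=
      (hlim.eventually_lt_const (by positivity)).and
        (hlim'.eventually_le_const (by positivity))
    have hfin := eventually_cofinite.1 hev
    obtain ⟨n, hn⟩ := (hfin.image fun w => ∑ i, w i).bddAbove
    refine ⟨n + 1, n.succ_pos, fun w hw => ?_⟩
    by_contra hcon
    have : ∑ i, w i ≤ n := hn ⟨w, hcon, rfl⟩
    omega
  obtain ⟨v, hv, s, hs, hp⟩ := hS n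
  rw [mem_latticeLevel] at hv
  have hlevel : ∀ w, v ≤ w → n ≤ ∑ i, w i := fun w hw =>
    hv ▸ Finset.sum_le_sum fun i _ => hw i
  obtain ⟨k, hkN, m, hm⟩ := hN (τ (E v))
  obtain ⟨s', hs', hp'⟩ := hp.add_nsmul_single i₀ (fun w hw => (hn w (hlevel w hw)).2) k
  set w := v + k • Pi.single i₀ 1 with hw
  have hs'S : s' ≤ S + 1 := by
    have : (k : ℝ) * (1 / (N + 1)) ≤ 1 := by
      rw [mul_one_div, div_le_one (by positivity)]
      have : (k : ℝ) ≤ N := by exact_mod_cast hkN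
      linarith
    linarith
  have hlw := (hn w (hlevel w (by simp [hw]))).1
  have hr := hp'.ratio_le hE hE0 hu hK hratio hab (by linarith) hl1 hδS hs'S
  have hwlen : E w (b + δ) - E w b ≤ l w := by
    refine le_of_mul_le_mul_right (hr.trans ?_) (sub_pos.2 hab)
    have := hl0 w
    calc (b + δ - b) * l w * Real.exp (K * s')
        ≤ (b + δ - b) * l w * Real.exp (K * (S + 1)) := by
          have : 0 ≤ b + δ - b := by linarith
          gcongr
      _ = l w * ((b + δ - b) * Real.exp (K * (S + 1))) := by ring
      _ ≤ l w * (b - a) := by gcongr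
  have hwlift : IsLiftOf (fun j => ((w j : ℕ) : ℤ)) (u i₀ ^ k * E v) := by
    have : (fun j => ((w j : ℕ) : ℤ)) = k • (Pi.single i₀ 1 : Fin d → ℤ) + fun j => (v j : ℤ) := by
      ext j
      rcases eq_or_ne j i₀ with rfl | hj
      · simp [hw, add_comm]
      · simp [hw, hj]
    rw [this]
    exact ((hu i₀).pow k).mul (hE v)
  obtain ⟨m', hm'⟩ := (hE w).exists_int_eq_add hwlift
  have hval : h (E w b) = h b + τ (E v) + k * τ (u i₀) + m' := by
    rw [hm', CircleDeg1Lift.map_add_int, Units.val_mul, CircleDeg1Lift.mul_apply,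
      Units.val_pow_eq_pow_val, CircleDeg1Lift.pow_semiconj (hh _ _ (hu i₀)), hh _ _ (hE v)]
  -- Modulo integers, `b` lands in `(b, b + δ / 2)` and the image of `[b, b + δ]` is shorter than `δ
  -- / 2`, so this interval is mapped into itself.
  have hlo : b < E w b + (m - m' : ℤ) := by
    by_contra! hcon
    have := h.monotone hcon
    rw [CircleDeg1Lift.map_add_int, hval] at this
    push_cast at this
    linarith [hm.1]
  have hhi : E w b + (m - m' : ℤ) < b + δ / 2 := by
    by_contra! hcon
    have := h.monotone hcon
    rw [CircleDeg1Lift.map_add_int, hval] at this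
    push_cast at this
    linarith [hm.2]
  have hc : ContinuousOn (fun x => E w x - x) (Icc b (b + δ)) :=
    ((CircleDeg1Lift.units_continuous (E w)).sub continuous_id).continuousOn
  obtain ⟨x, -, hx⟩ := intermediate_value_Icc' (by linarith) hc
    (show -((m - m' : ℤ) : ℝ) ∈ _ from ⟨by linarith, by linarith⟩)
  have hw0 := (hE w).eq_zero_of_apply_eq hfree (x := x) (k := -(m - m')) (by
    push_cast at hx ⊢
    linarith)
  have hwz : w = 0 := hinj (hw0.trans (by ext; simp))
  have := hlevel w (by simp [hw])
  simp [hwz] at this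
  omega

end

/-! ### Assembling the theorem -/

theorem mainTheorem1 (d : ℕ) (hd : 2 ≤ d) (ε : ℝ) (hε : 0 < ε)
    [AddAction (Fin d → ℤ) UnitAddCircle]
    (hfree : IsFreeAddAction (Fin d → ℤ) UnitAddCircle)
    (hclass : ∀ n : Fin d → ℤ,
      IsCircleDiffeoOfClass (1 + 1 / (d : ℝ) + ε)
        (AddAction.toPerm n : UnitAddCircle ≃ UnitAddCircle)) :
    AddAction.IsMinimal (Fin d → ℤ) UnitAddCircle := by
  have hd2 : (2 : ℝ) ≤ d := by exact_mod_cast hd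
  have hd0 : (0 : ℝ) < d := by linarith
  obtain ⟨σ, hdσ, hσ1, hσr⟩ : ∃ σ : ℝ, 1 / (d : ℝ) < σ ∧ σ < 1 ∧ σ ≤ 1 / (d : ℝ) + ε := by
    have : 1 / (d : ℝ) ≤ 1 / 2 := one_div_le_one_div_of_le two_pos hd2
    -- The cap `3 / 4` keeps `σ < 1` for large `ε`, and still exceeds `1 / d ≤ 1 / 2`.
    exact ⟨min (1 / d + ε) (3 / 4), lt_min (by linarith) (by linarith),
      (min_le_right _ _).trans_lt (by norm_num), min_le_left _ _⟩
  have hσ : 0 < σ := lt_trans (by positivity) hdσ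
  have hexists : ∀ n : Fin d → ℤ, n ≠ 0 → ∃ u : CircleDeg1Liftˣ, IsLiftOf n u ∧
      ∃ K, 0 ≤ K ∧ ∀ a b c, a < b → b < c → c - b ≤ b - a → b - a ≤ 1 →
        (u c - u b) * (b - a) ≤ (c - b) * (u b - u a) * Real.exp (K * (b - a) ^ σ) :=
    fun n hn => (hclass n).exists_lift (fun x hx => hn (hfree n x hx)) hσ hσ1 (by linarith)
  have hlift : ∀ n : Fin d → ℤ, ∃ u, IsLiftOf n u := fun n => by
    rcases eq_or_ne n 0 with rfl | hn
    · exact ⟨1, .one⟩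
    · exact (hexists n hn).imp fun _ => And.left
  choose u hu K hK0 hK using fun i : Fin d => hexists (Pi.single i 1) (by simp)
  obtain ⟨h, hh⟩ := exists_semiconj_translationNumber (Fin d → ℤ)
  let i₀ : Fin d := ⟨0, by omega⟩
  have hirr : Irrational (τ (u i₀)) := (hu i₀).irrational hfree fun k hk h0 => by
    simpa [hk.ne'] using congrFun h0 i₀
  have hcont := CircleDeg1Lift.continuous_of_semiconj_irrational hirr (hh _ _ (hu i₀))
  refine isMinimal_of_semiconj_irrational ?_ (hu i₀) hirr (hh _ _ (hu i₀))
  refine strictMono_of_ratio_distortion hfree hh hcont hlift hu i₀ hirr (K := ∑ i, K i) hσ hσ1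
    ((div_lt_iff₀' hd0).1 hdσ) (Finset.sum_nonneg fun i _ => hK0 i)
    fun i a b c hab hbc hle h1 => (hK i a b c hab hbc hle h1).trans ?_
  have hsub : u i a ≤ u i b := (u i).val.monotone hab.le
  have hKi : K i ≤ ∑ i, K i := Finset.single_le_sum (fun i _ => hK0 i) (Finset.mem_univ i)
  have h1 : 0 ≤ (c - b) * (u i b - u i a) := mul_nonneg (by linarith) (by linarith)
  have h2 : 0 ≤ (b - a) ^ σ := Real.rpow_nonneg (by linarith) _
  gcongr
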